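/- A function $f:\mathbb R\to\mathbb R$ is called almost periodic if it is continuous and, for every $\varepsilon>0$, the set of all $\tau\in\mathbb R$ with $\sup_{x\in\mathbb R}|f(x+\tau)-f(x)|<\varepsilon$ is relatively dense, i.e. there is $R<\infty$ such that every open interval of length $2R$ contains such a $\tau$. A Borel measure $\mu$ on $\mathbb R$ is called almost periodic if, for every continuous compactly supported $\varphi:\mathbb R\to\mathbb R$, the function $x\mapsto\int\varphi(x+t)\,d\mu(t)$ is almost periodic. A multiple discrete set $A$ in $\mathbb R$ is a set $s(A)\subset\mathbb R$ having only finitely many points in each compact set, together with a multiplicity $m(x)\in\{1,2,\dots\}$ for each $x\in s(A)$. It is called almost periodic if the measure $\mu_A=\sum_{x\in s(A)}m(x)\delta_x$ is almost periodic. It has density $D$ if $\frac1{2R}\sum_{x'\in s(A),\,|x'-x|<R}m(x')\to D$ as $R\to\infty$, uniformly in $x\in\mathbb R$. **Theorem.** Let $A$ be an almost periodic multiple discrete set in $\mathbb R$, enumerated as $A=(a_k)_{k\in\mathbb Z}$ with $a_k\le a_{k+1}$ for all $k$, each $x\in s(A)$ occurring exactly $m(x)$ times among the $a_k$ and no other values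 occurring. Then $A$ has a density $D$, this density satisfies $0<D<\infty$, and there is an almost periodic function $f:\mathbb R\to\mathbb R$ such that $$a_k=\frac{k}{D}+f(k)\qquad\text{for all }k\in\mathbb Z .$$ -/

import Mathlib

open MeasureTheory Filter

/-- A set `S ⊆ ℝ` is relatively dense if for some radius `R` every open ball of radius `R`
(that is, every open interval of length `2R`) contains a point of `S`. -/
def IsRelativelyDense (S : Set ℝ) : Prop :=
  ∃ R : ℝ, ∀ c : ℝ, ∃ τ ∈ S, τ ∈ Metric.ball c R

/-- The set of `ε`-almost periods of `f`, i.e. of all `τ` with `sup_x |f (x + τ) - f x| < ε`.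
The supremum is smaller than `ε` exactly when some `δ < ε` is an upper bound. -/
def almostPeriods (f : ℝ → ℝ) (ε : ℝ) : Set ℝ :=
  {τ | ∃ δ < ε, ∀ x : ℝ, |f (x + τ) - f x| ≤ δ}

/-- (Bohr) almost periodic functions on the real line. -/
def IsAlmostPeriodic (f : ℝ → ℝ) : Prop :=
  Continuous f ∧ ∀ ε : ℝ, 0 < ε → IsRelativelyDense (almostPeriods f ε)

/-- A Borel measure on `ℝ` is almost periodic (in the weak sense) if all its convolutions with
continuous functions of compact support are almost periodic functions. -/
def IsAlmostPeriodicMeasure (μ : Measure ℝ) : Prop :=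
  ∀ φ : ℝ → ℝ, Continuous φ → HasCompactSupport φ →
    IsAlmostPeriodic (fun x => ∫ t, φ (x + t) ∂μ)

/-- A multiple discrete set in `ℝ`: a set of points without finite accumulation points, each
of which carries a positive integer multiplicity. It is encoded by the multiplicity function,
which is extended by `0` to the points that do not belong to the set. -/
structure MultipleDiscreteSet where
  /-- the multiplicity of a point -/
  mult : ℝ → ℕ
  /-- every compact set contains only finitely many points of the set -/
  finite_inter : ∀ K : Set ℝ, IsCompact K → (Function.support mult ∩ K).Finite

namespace MultipleDiscreteSet

/-- The underlying discrete set `s(A)`. -/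
def points (A : MultipleDiscreteSet) : Set ℝ := Function.support A.mult

/-- The associated measure `∑_{x ∈ s(A)} m(x) δ_x`. -/
noncomputable def toMeasure (A : MultipleDiscreteSet) : Measure ℝ :=
  Measure.sum fun x : A.points => (A.mult x : ENNReal) • Measure.dirac (x : ℝ)

/-- A multiple discrete set is almost periodic if its associated measure is. -/
def AlmostPeriodic (A : MultipleDiscreteSet) : Prop :=
  IsAlmostPeriodicMeasure A.toMeasure

/-- `card (A ∩ E)`, the number of points of `A` in a bounded set `E`, counted with
multiplicities. The sum has only finitely many nonzero terms because `E` is bounded. -/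
noncomputable def card (A : MultipleDiscreteSet) (E : Set ℝ) : ℕ :=
  ∑ᶠ x ∈ E, A.mult x

/-- `A` has density `D`: `card (A ∩ B(x, R)) / (2 R) → D` as `R → ∞`, uniformly in `x ∈ ℝ`. -/
def HasDensity (A : MultipleDiscreteSet) (D : ℝ) : Prop :=
  TendstoUniformly (fun (R x : ℝ) => (A.card (Metric.ball x R) : ℝ) / (2 * R)) (fun _ => D) atTop

/-- `A = (a_k)_{k ∈ ℤ}` with `a_k ≤ a_{k+1}`: the sequence is nondecreasing and takes each real
value `x` exactly `m(x)` times (in particular not at all if `x` is not a point of `A`). -/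
def IsEnumeration (A : MultipleDiscreteSet) (a : ℤ → ℝ) : Prop :=
  (∀ k : ℤ, a k ≤ a (k + 1)) ∧ ∀ x : ℝ, {k : ℤ | a k = x}.encard = (A.mult x : ℕ∞)

end MultipleDiscreteSet

/-! ### Measure and counts in terms of an enumeration -/

namespace MultipleDiscreteSet

variable {A : MultipleDiscreteSet} {a : ℤ → ℝ}

/-! Almost periodicity of the measure is upgraded to almost periodicity of the sequence up to index
shifts (`AlmostPeriodic.exists_shift`): for relatively dense `τ` there is an integer `h` with `a (k
+ h) - a k` within `ε` of `τ` for all `k`. Test the measure against tents of small width `w`. The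
number of points per unit length is bounded, so every block of boundedly many grid cells has a gap.
An almost period keeps the gap centres free of translated points, and since integer translates of
the tent sum to one, the counts between consecutive gaps differ by less than one, hence agree. So
one index shift matches all points (`exists_shift_abs_sub_le`).

Iterating such shifts forces a common slope `α > 0` with `|τ - α * h| ≤ ε` (`exists_slope`). Then `a
k - α * k` changes by at most `2 * ε` under relatively dense integer shifts `h`, and its linear
interpolation is the almost periodic `f`. As `f` is bounded, counting points gives the density `1 /
α`. -/

theorem IsEnumeration.monotone (ha : A.IsEnumeration a) : Monotone a :=
  monotone_int_of_le_succ ha.1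

theorem IsEnumeration.finite_setOf_mem_Icc (ha : A.IsEnumeration a) (u v : ℝ) :
    {k : ℤ | a k ∈ Set.Icc u v}.Finite := by
  have hsub : {k : ℤ | a k ∈ Set.Icc u v} ⊆
      ⋃ x ∈ Function.support A.mult ∩ Set.Icc u v, {k : ℤ | a k = x} := by
    intro k hk
    refine Set.mem_biUnion (x := a k) ⟨?_, hk⟩ rfl
    intro h0
    have h1 := ha.2 (a k)
    rw [h0, Nat.cast_zero, Set.encard_eq_zero] at h1
    exact Set.eq_empty_iff_forall_notMem.1 h1 k rfl
  refine ((A.finite_inter _ isCompact_Icc).biUnion fun x _ => ?_).subset hsub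
  exact Set.finite_of_encard_eq_coe (ha.2 x)

theorem IsEnumeration.toMeasure_eq_map_count (ha : A.IsEnumeration a) :
    A.toMeasure = Measure.map a Measure.count := by
  ext E hE
  rw [toMeasure, Measure.sum_apply _ hE, Measure.map_apply (measurable_of_countable a) hE,
    Measure.count_apply ((measurable_of_countable a) hE)]
  have h1 : ∀ x : ℝ, ∑' k : a ⁻¹' {x}, E.indicator (1 : ℝ → ENNReal) (a k) =
      (A.mult x : ENNReal) * E.indicator 1 x := by
    intro x
    have h2 : ∀ k : a ⁻¹' {x}, E.indicator (1 : ℝ → ENNReal) (a k) = E.indicator 1 x := by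
      rintro ⟨k, hk⟩
      rw [show a k = x from hk]
    rw [tsum_congr h2, ENNReal.tsum_set_const]
    have h3 : (a ⁻¹' {x}).encard = (A.mult x : ℕ∞) := ha.2 x
    rw [h3]
    simp
  -- The count over indices is regrouped by the fibres of `a`; the fibre over `x` has `A.mult x`
  -- elements.
  have h4 := ENNReal.tsum_fiberwise (fun k => E.indicator (1 : ℝ → ENNReal) (a k)) a
  simp_rw [h1] at h4
  have h5 : ((a ⁻¹' E).encard : ENNReal) = ∑' k, E.indicator (1 : ℝ → ENNReal) (a k) := by
    rw [← ENNReal.tsum_set_one, tsum_subtype (a ⁻¹' E) fun _ => (1 : ENNReal)]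
    rfl
  rw [h5, ← h4]
  rw [← tsum_subtype_eq_of_support_subset (s := A.points)]
  · refine tsum_congr fun x => ?_
    simp [Measure.dirac_apply' _ hE]
  · intro x hx h0
    apply hx
    simp only [h0, Nat.cast_zero, zero_mul]

theorem IsEnumeration.finite_support_comp (ha : A.IsEnumeration a) {φ : ℝ → ℝ}
    (hφ : HasCompactSupport φ) (x : ℝ) : (Function.support fun k => φ (x + a k)).Finite := by
  obtain ⟨r, hr⟩ := hφ.isCompact.isBounded.subset_closedBall 0
  refine (ha.finite_setOf_mem_Icc (-r - x) (r - x)).subset fun k hk => ?_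
  have := hr (subset_tsupport φ hk)
  rw [Metric.mem_closedBall, Real.dist_eq, sub_zero, abs_le] at this
  constructor <;> linarith

theorem IsEnumeration.integral_toMeasure (ha : A.IsEnumeration a) {φ : ℝ → ℝ}
    (hc : Continuous φ) (hφ : HasCompactSupport φ) (x : ℝ) :
    ∫ t, φ (x + t) ∂A.toMeasure = ∑' k, φ (x + a k) := by
  have hm : Continuous fun t => φ (x + t) := by fun_prop
  rw [ha.toMeasure_eq_map_count, integral_map (measurable_of_countable a).aemeasurable
    hm.aestronglyMeasurable, integral_countable]
  · simp [Measure.real]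
  · rw [integrable_count_iff]
    exact (summable_of_hasFiniteSupport (ha.finite_support_comp hφ x)).norm

theorem IsEnumeration.card_eq_ncard (ha : A.IsEnumeration a) {E : Set ℝ} {u v : ℝ}
    (hE : E ⊆ Set.Icc u v) : A.card E = {k : ℤ | a k ∈ E}.ncard := by
  classical
  have hfin : {k : ℤ | a k ∈ E}.Finite :=
    (ha.finite_setOf_mem_Icc u v).subset fun k hk => hE hk
  have hfib : ∀ x ∈ E, A.mult x = (hfin.toFinset.filter fun k => a k = x).card := by
    intro x hx
    have h1 : {k : ℤ | a k = x}.ncard = A.mult x := by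
      rw [Set.ncard, ha.2 x, ENat.toNat_natCast]
    rw [← h1, ← Set.ncard_coe_finset]
    congr 1
    ext k
    simp only [Finset.coe_filter, Set.Finite.mem_toFinset, Set.mem_ofPred_eq]
    exact ⟨fun h => ⟨h ▸ hx, h⟩, fun h => h.2⟩
  rw [card, finsum_mem_eq_sum_of_inter_support_eq (t := hfin.toFinset.image a),
    Set.ncard_eq_toFinset_card _ hfin,
    Finset.card_eq_sum_card_fiberwise (f := a) (t := hfin.toFinset.image a)
      (fun k hk => Finset.mem_image_of_mem a hk)]
  · refine Finset.sum_congr rfl fun x hx => hfib x ?_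
    obtain ⟨k, hk, rfl⟩ := Finset.mem_image.1 hx
    exact hfin.mem_toFinset.1 hk
  · ext x
    simp only [Set.mem_inter_iff, Function.mem_support, Finset.coe_image,
      Set.Finite.coe_toFinset, Set.mem_image, Set.mem_ofPred_eq]
    constructor
    · rintro ⟨hx, h0⟩
      obtain ⟨k, hk⟩ := Finset.card_pos.1 (Nat.pos_of_ne_zero (hfib x hx ▸ h0))
      rw [Finset.mem_filter, hfin.mem_toFinset] at hk
      exact ⟨⟨k, hk.1, hk.2⟩, h0⟩
    · rintro ⟨⟨k, hk, rfl⟩, h0⟩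
      exact ⟨hk, h0⟩

end MultipleDiscreteSet

/-! ### Proper monotone sequences -/

/-- A two-sided nondecreasing sequence that meets every bounded interval finitely often. -/
structure IsProperMonotone (x : ℤ → ℝ) : Prop where
  mono : Monotone x
  finite : ∀ u v : ℝ, {k : ℤ | x k ∈ Set.Icc u v}.Finite

namespace IsProperMonotone

variable {x : ℤ → ℝ}

theorem exists_forall_lt_iff (hx : IsProperMonotone x) (c : ℝ) :
    ∃ n : ℤ, ∀ k : ℤ, x k < c ↔ k < n := by
  have hlow : ∃ k, x k < c := by
    by_contra! h
    refine (Set.Iic_infinite (0 : ℤ)) ((hx.finite c (x 0)).subset fun k hk => ?_)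
    exact ⟨h k, hx.mono hk⟩
  have hup : ∃ k, c ≤ x k := by
    by_contra! h
    refine (Set.Ici_infinite (0 : ℤ)) ((hx.finite (x 0) c).subset fun k hk => ?_)
    exact ⟨hx.mono hk, (h k).le⟩
  obtain ⟨l, hl⟩ := hlow
  obtain ⟨n, hn, hmin⟩ := Int.exists_least_of_bdd (P := fun k => c ≤ x k)
    ⟨l, fun z hz => le_of_not_gt fun h => absurd (hx.mono h.le) (by linarith)⟩ hup
  refine ⟨n, fun k => ⟨fun h => ?_, fun h => ?_⟩⟩
  · by_contra! h'
    exact absurd (hx.mono h') (by linarith)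
  · by_contra! h'
    exact absurd (hmin k h') (by omega)

theorem div_const (hx : IsProperMonotone x) (s : ℝ) {w : ℝ} (hw : 0 < w) :
    IsProperMonotone fun k => (s + x k) / w := by
  refine ⟨fun i j h => ?_, fun u v => ?_⟩
  · have := hx.mono h
    gcongr
  · refine (hx.finite (u * w - s) (v * w - s)).subset fun k hk => ?_
    obtain ⟨h1, h2⟩ := hk
    rw [le_div_iff₀ hw] at h1
    rw [div_le_iff₀ hw] at h2
    constructor <;> linarith

end IsProperMonotone

/-! ### Tents as a partition of unity -/

/-- The piecewise linear function that is `0` on the negative axis and `1` on `[1, ∞)`. -/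
noncomputable def ramp (s : ℝ) : ℝ := max 0 (min 1 s)

/-- The tent function with apex at `0` and support `[-1, 1]`. -/
noncomputable def tent (s : ℝ) : ℝ := ramp (s + 1) - ramp s

theorem ramp_of_nonpos {s : ℝ} (h : s ≤ 0) : ramp s = 0 := by
  rw [ramp, max_eq_left]
  exact (min_le_right _ _).trans h

theorem ramp_of_one_le {s : ℝ} (h : 1 ≤ s) : ramp s = 1 := by
  simp [ramp, h]

theorem ramp_of_mem {s : ℝ} (h0 : 0 ≤ s) (h1 : s ≤ 1) : ramp s = s := by
  simp [ramp, h0, h1]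

theorem ramp_mono : Monotone ramp := fun s t h => by
  unfold ramp
  gcongr

theorem continuous_tent : Continuous tent := by
  unfold tent ramp
  fun_prop

theorem tent_nonneg (s : ℝ) : 0 ≤ tent s :=
  sub_nonneg.2 (ramp_mono (by linarith))

theorem tent_of_one_le_abs {s : ℝ} (h : 1 ≤ |s|) : tent s = 0 := by
  unfold tent
  rcases le_abs.1 h with h | h
  · rw [ramp_of_one_le h, ramp_of_one_le (by linarith), sub_self]
  · rw [ramp_of_nonpos (by linarith), ramp_of_nonpos (by linarith), sub_self]

theorem half_le_tent {s : ℝ} (h : |s| ≤ 1 / 2) : 1 / 2 ≤ tent s := by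
  obtain ⟨h1, h2⟩ := abs_le.1 h
  unfold tent
  rcases le_total s 0 with h0 | h0
  · rw [ramp_of_nonpos h0, ramp_of_mem (by linarith) (by linarith)]
    linarith
  · rw [ramp_of_one_le (s := s + 1) (by linarith), ramp_of_mem h0 (by linarith)]
    linarith

/-- Writing the tent as a difference of ramps makes the sum telescope. -/
theorem sum_range_tent (s : ℝ) (n : ℕ) :
    ∑ i ∈ Finset.range n, tent (s - i) = ramp (s + 1) - ramp (s + 1 - n) := by
  induction n with
  | zero => simp
  | succ n ih =>
    rw [Finset.sum_range_succ, ih, tent, Nat.cast_succ,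
      show s - n + 1 = s + 1 - n by ring, show s + 1 - (n + 1) = s - n by ring]
    ring

/-! ### Matching two sequences through their tent sums -/

namespace IsProperMonotone

variable {x y : ℤ → ℝ}

theorem finite_support_tent (hx : IsProperMonotone x) (c : ℝ) :
    (Function.support fun k => tent (x k - c)).Finite := by
  refine (hx.finite (c - 1) (c + 1)).subset fun k hk => ?_
  have h : ¬ 1 ≤ |x k - c| := fun h => hk (tent_of_one_le_abs h)
  obtain ⟨h1, h2⟩ := abs_lt.1 (not_le.1 h)
  constructor <;> linarith

theorem summable_tent (hx : IsProperMonotone x) (c : ℝ) : Summable fun k => tent (x k - c) :=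
  summable_of_hasFiniteSupport (hx.finite_support_tent c)

theorem half_le_tsum_tent (hx : IsProperMonotone x) {c : ℝ} {k : ℤ} (h : |x k - c| ≤ 1 / 2) :
    1 / 2 ≤ ∑' k, tent (x k - c) :=
  (half_le_tent h).trans ((hx.summable_tent c).le_tsum k fun _ _ => tent_nonneg _)

/-- If the two ends of an integer interval are at distance at least `1` from all points of the
sequence, then the tents in between count the points of the interval. -/
theorem sum_tsum_tent (hx : IsProperMonotone x) {p : ℤ} {n : ℕ} {i j : ℤ}
    (hp : ∀ k, 1 ≤ |x k - p|) (hq : ∀ k, 1 ≤ |x k - (p + n : ℤ)|)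
    (hi : ∀ k, x k < p ↔ k < i) (hj : ∀ k, x k < (p + n : ℤ) ↔ k < j) :
    ∑ m ∈ Finset.range n, ∑' k, tent (x k - (p + m : ℤ)) = (j : ℝ) - i := by
  have hij : i ≤ j := by
    by_contra! h
    have h1 := (hi j).2 h
    have h2 : ¬ x j < (p + n : ℤ) := fun h => lt_irrefl _ ((hj j).1 h)
    push_cast at h2
    have : (0 : ℝ) ≤ n := n.cast_nonneg
    linarith
  rw [← Summable.tsum_finsetSum fun m _ => hx.summable_tent _]
  have hterm : ∀ k, ∑ m ∈ Finset.range n, tent (x k - (p + m : ℤ)) =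
      if k ∈ Finset.Ico i j then 1 else 0 := by
    intro k
    have h1 := sum_range_tent (x k - p) n
    have h2 : ∀ m : ℕ, x k - (p + m : ℤ) = x k - p - m := fun m => by push_cast; ring
    have hqk := hq k
    have hpk := hp k
    have hik := hi k
    have hjk := hj k
    simp_rw [h2] at hqk ⊢
    rw [h1]
    have hn : (0 : ℝ) ≤ n := n.cast_nonneg
    push_cast at hjk
    rcases le_abs.1 hpk with h | h
    · rw [ramp_of_one_le (by linarith)]
      have : i ≤ k := not_lt.1 fun h' => absurd (hik.2 h') (by linarith)
      rcases le_abs.1 hqk with h' | h'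
      · rw [ramp_of_one_le (by linarith), if_neg, sub_self]
        rw [Finset.mem_Ico, not_and]
        intro _ h''
        have := hjk.2 h''
        linarith
      · rw [ramp_of_nonpos (by linarith), if_pos, sub_zero]
        exact Finset.mem_Ico.2 ⟨this, hjk.1 (by linarith)⟩
    · rw [ramp_of_nonpos (by linarith), ramp_of_nonpos (by linarith), if_neg, sub_self]
      rw [Finset.mem_Ico, not_and]
      intro h''
      exact absurd (hik.1 (by linarith)) (by omega)
  simp_rw [hterm]
  rw [tsum_eq_sum (s := Finset.Ico i j) (fun k hk => if_neg hk),
    Finset.sum_ite_mem, Finset.inter_self, Finset.sum_const, Int.card_Ico, nsmul_one]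
  rw [← Int.cast_natCast, Int.toNat_of_nonneg (by omega)]
  push_cast
  ring

/-- Two sequences whose tent sums are close at all integers agree up to a shift of the index,
provided that the first one has gaps with bounded distances. -/
theorem exists_shift_abs_sub_le (hx : IsProperMonotone x) (hy : IsProperMonotone y)
    {B : ℕ} {δ : ℝ} (hB : 1 ≤ B) (hδ : 2 * B * δ < 1)
    (hgap : ∀ j : ℤ, ∃ p : ℤ, j * B ≤ p ∧ p < (j + 1) * B ∧ ∀ k, 2 ≤ |x k - p|)
    (hxy : ∀ i : ℤ, |∑' k, tent (y k - i) - ∑' k, tent (x k - i)| ≤ δ) :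
    ∃ h : ℤ, ∀ k, |y (k + h) - x k| ≤ 3 * B := by
  choose p hp1 hp2 hp using hgap
  have hB' : (1 : ℝ) ≤ B := by exact_mod_cast hB
  have hδ0 : 0 ≤ δ := (abs_nonneg _).trans (hxy 0)
  have hδ2 : δ < 1 / 2 := by nlinarith
  -- A point of `y` within `1` of `p j` is within `1/2` of some `i` among `p j - 1`, `p j`, `p j +
  -- 1`. There the tent sum of `x` vanishes while that of `y` is at least `1/2 > δ`.
  have hyfar : ∀ j k, 1 ≤ |y k - p j| := by
    intro j k
    by_contra! hlt
    obtain ⟨i, hi, hi1⟩ : ∃ i : ℤ, |(i : ℝ) - p j| ≤ 1 ∧ |y k - i| ≤ 1 / 2 := by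
      obtain ⟨h1, h2⟩ := abs_lt.1 hlt
      rcases le_total (y k - p j) (-1 / 2) with h | h
      · exact ⟨p j - 1, by push_cast; rw [abs_le]; constructor <;> linarith,
          by push_cast; rw [abs_le]; constructor <;> linarith⟩
      rcases le_total (y k - p j) (1 / 2) with h' | h'
      · exact ⟨p j, by simp, by rw [abs_le]; constructor <;> linarith⟩
      · exact ⟨p j + 1, by push_cast; rw [abs_le]; constructor <;> linarith,
          by push_cast; rw [abs_le]; constructor <;> linarith⟩
    have hzero : ∑' k, tent (x k - i) = 0 := by
      rw [tsum_congr (g := fun _ => 0), tsum_zero]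
      intro k
      apply tent_of_one_le_abs
      have h1 := abs_sub_le (x k) i (p j)
      have h2 := hp j k
      linarith
    have h1 := hy.half_le_tsum_tent hi1
    have h2 := hxy i
    rw [hzero, sub_zero] at h2
    linarith [le_abs_self (∑' k, tent (y k - i))]
  have hxfar : ∀ j k, 1 ≤ |x k - p j| := fun j k => by linarith [hp j k]
  choose nx hnx using fun j => hx.exists_forall_lt_iff (p j)
  choose ny hny using fun j => hy.exists_forall_lt_iff (p j)
  -- Consecutive gaps are at most `2 * B` apart, so the two integer counts between them differ by at
  -- most `2 * B * δ < 1`.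
  have hstep : ∀ j, ny (j + 1) - nx (j + 1) = ny j - nx j := by
    intro j
    have hlt : p j < p (j + 1) := (hp2 j).trans_le (hp1 (j + 1))
    obtain ⟨n, hn⟩ : ∃ n : ℕ, p (j + 1) = p j + n := ⟨(p (j + 1) - p j).toNat, by omega⟩
    have hn2 : (n : ℤ) ≤ 2 * B := by
      have h1 := hp1 j
      have h2 := hp2 (j + 1)
      nlinarith
    have hx1 := hx.sum_tsum_tent (n := n) (hxfar j) (hn ▸ hxfar (j + 1)) (hnx j)
      (hn ▸ hnx (j + 1))
    have hy1 := hy.sum_tsum_tent (n := n) (hyfar j) (hn ▸ hyfar (j + 1)) (hny j)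
      (hn ▸ hny (j + 1))
    have hsum : |((ny (j + 1) : ℝ) - ny j) - (nx (j + 1) - nx j)| ≤ n * δ := by
      rw [← hx1, ← hy1, ← Finset.sum_sub_distrib]
      refine (Finset.abs_sum_le_sum_abs _ _).trans ?_
      refine (Finset.sum_le_sum fun m _ => hxy _).trans ?_
      simp
    have hn3 : (n : ℝ) ≤ 2 * B := by exact_mod_cast hn2
    have h3 : |((ny (j + 1) : ℝ) - ny j) - (nx (j + 1) - nx j)| < 1 := by
      refine hsum.trans_lt (lt_of_le_of_lt ?_ hδ)
      gcongr
    have h4 : |(ny (j + 1) - ny j) - (nx (j + 1) - nx j)| < 1 := by exact_mod_cast h3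
    rw [Int.abs_lt_one_iff] at h4
    omega
  have hconst : ∀ j, ny j - nx j = ny 0 - nx 0 := by
    intro j
    induction j using Int.induction_on with
    | zero => rfl
    | succ i ih => rw [hstep, ih]
    | pred i ih =>
      rw [← ih]
      have := hstep (-(i : ℤ) - 1)
      rw [sub_add_cancel] at this
      exact this.symm
  refine ⟨ny 0 - nx 0, fun k => ?_⟩
  -- Both `x k` and its partner lie between `p (j - 1)` and `p (j + 1)`, inside an interval of
  -- length `3 * B`.
  set j := ⌊x k / B⌋ with hj
  have hB0 : (0 : ℝ) < B := by linarith
  have hj1 : (j : ℝ) * B ≤ x k := by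
    rw [← le_div_iff₀ hB0]
    exact Int.floor_le _
  have hj2 : x k < (j + 1) * B := by
    rw [← div_lt_iff₀ hB0]
    exact Int.lt_floor_add_one _
  have q1 : ((j - 1 : ℤ) : ℝ) * B ≤ p (j - 1) := by exact_mod_cast hp1 (j - 1)
  have q2 : (p (j - 1) : ℝ) < ((j - 1 : ℤ) + 1) * B := by exact_mod_cast hp2 (j - 1)
  have q3 : ((j + 1 : ℤ) : ℝ) * B ≤ p (j + 1) := by exact_mod_cast hp1 (j + 1)
  have q4 : (p (j + 1) : ℝ) < ((j + 1 : ℤ) + 1) * B := by exact_mod_cast hp2 (j + 1)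
  push_cast at q1 q2 q3 q4
  have k1 : nx (j - 1) ≤ k := not_lt.1 fun h => absurd ((hnx (j - 1) k).2 h) (by linarith)
  have k2 : k < nx (j + 1) := (hnx (j + 1) k).1 (by linarith)
  have c1 := hconst (j - 1)
  have c2 := hconst (j + 1)
  have y1 : ¬ y (k + (ny 0 - nx 0)) < p (j - 1) := by
    rw [hny]
    omega
  have y2 : y (k + (ny 0 - nx 0)) < p (j + 1) := by
    rw [hny]
    omega
  rw [abs_le]
  constructor <;> linarith

end IsProperMonotone

/-! ### From almost periods to index shifts -/

theorem IsAlmostPeriodic.exists_abs_le {f : ℝ → ℝ} (hf : IsAlmostPeriodic f) :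
    ∃ C, ∀ x, |f x| ≤ C := by
  obtain ⟨R, hR⟩ := hf.2 1 one_pos
  obtain ⟨C, hC⟩ := (isCompact_closedBall (0 : ℝ) R).exists_bound_of_continuousOn hf.1.continuousOn
  refine ⟨C + 1, fun x => ?_⟩
  -- An almost period near `-x` moves `x` into the compact ball of radius `R`.
  obtain ⟨τ, ⟨δ, hδ, hτ⟩, hball⟩ := hR (-x)
  have h1 : |f (x + τ)| ≤ C := by
    refine hC _ (Metric.mem_closedBall.2 ?_)
    rw [Metric.mem_ball, Real.dist_eq] at hball
    rw [Real.dist_eq, sub_zero, add_comm, ← sub_neg_eq_add]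
    exact hball.le
  have h2 := hτ x
  rw [abs_le] at *
  constructor <;> linarith

theorem hasCompactSupport_tent_div {w : ℝ} (hw : 0 < w) :
    HasCompactSupport fun t => tent (t / w) := by
  refine HasCompactSupport.intro (K := Set.Icc (-w) w) isCompact_Icc fun t ht => ?_
  refine tent_of_one_le_abs (le_of_not_gt fun h => ht ?_)
  rw [abs_div, abs_of_pos hw, div_lt_one hw, abs_lt] at h
  exact ⟨h.1.le, h.2.le⟩

namespace MultipleDiscreteSet

variable {A : MultipleDiscreteSet} {a : ℤ → ℝ}

theorem IsEnumeration.isProperMonotone (ha : A.IsEnumeration a) : IsProperMonotone a :=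
  ⟨ha.monotone, ha.finite_setOf_mem_Icc⟩

theorem AlmostPeriodic.isAlmostPeriodic_tsum_tent (hA : A.AlmostPeriodic)
    (ha : A.IsEnumeration a) {w : ℝ} (hw : 0 < w) :
    IsAlmostPeriodic fun x => ∑' k, tent ((x + a k) / w) := by
  have hc : Continuous fun t => tent (t / w) := continuous_tent.comp (by fun_prop)
  have h := hA _ hc (hasCompactSupport_tent_div hw)
  convert h using 2 with x
  exact (ha.integral_toMeasure hc (hasCompactSupport_tent_div hw) x).symm

/-- An almost periodic multiple discrete set has boundedly many points in intervals of
length one. -/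
theorem AlmostPeriodic.exists_add_one_lt (hA : A.AlmostPeriodic) (ha : A.IsEnumeration a) :
    ∃ M : ℕ, ∀ k : ℤ, a k + 1 < a (k + M) := by
  obtain ⟨C, hC⟩ := (hA.isAlmostPeriodic_tsum_tent ha two_pos).exists_abs_le
  obtain ⟨M, hM⟩ := exists_nat_gt (2 * C)
  refine ⟨M, fun k => ?_⟩
  by_contra! hle
  have hfin : Summable fun i => tent ((-a k + a i) / 2) :=
    summable_of_hasFiniteSupport
      (ha.finite_support_comp (hasCompactSupport_tent_div two_pos) (-a k))
  have h1 : ∑ i ∈ Finset.Ico k (k + M), (1 / 2 : ℝ) ≤ ∑' i, tent ((-a k + a i) / 2) := by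
    refine le_trans (Finset.sum_le_sum fun i hi => half_le_tent ?_)
      (hfin.sum_le_tsum (Finset.Ico k (k + M)) fun i _ => tent_nonneg _)
    rw [Finset.mem_Ico] at hi
    have h2 := ha.monotone hi.1
    have h3 := ha.monotone hi.2.le
    rw [abs_le]
    constructor <;> linarith
  rw [Finset.sum_const, Int.card_Ico, add_sub_cancel_left, Int.toNat_natCast, nsmul_eq_mul] at h1
  have h4 := (le_abs_self _).trans (hC (-a k))
  linarith

/-- The points of an almost periodic multiple discrete set can be matched with the points of
its translate by an almost period by a shift of the index. -/
theorem AlmostPeriodic.exists_shift (hA : A.AlmostPeriodic) (ha : A.IsEnumeration a) {ε : ℝ}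
    (hε : 0 < ε) : ∃ R : ℝ, ∀ c : ℝ, ∃ τ : ℝ, |τ - c| < R ∧
      ∃ h : ℤ, ∀ k, |a (k + h) - a k - τ| ≤ ε := by
  obtain ⟨M, hM⟩ := hA.exists_add_one_lt ha
  -- A block of `B` cells holds `M + 1` disjoint windows of length `4`; `B * w ≤ 1` makes it too
  -- short for all of them to be hit.
  obtain ⟨B, hBM⟩ : ∃ B : ℕ, B = 4 * (M + 1) := ⟨_, rfl⟩
  have hB0 : (0 : ℝ) < B := by
    rw [hBM]
    positivity
  obtain ⟨w, hw0, hw1, hwε⟩ : ∃ w : ℝ, 0 < w ∧ B * w ≤ 1 ∧ 3 * B * w ≤ ε := by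
    refine ⟨min 1 (ε / 3) / B, by positivity, ?_, ?_⟩
    · rw [mul_div_cancel₀ _ hB0.ne']
      exact min_le_left _ _
    · rw [mul_assoc, mul_div_cancel₀ _ hB0.ne']
      linarith [min_le_right 1 (ε / 3)]
  obtain ⟨R, hR⟩ := (hA.isAlmostPeriodic_tsum_tent ha hw0).2 (1 / (4 * B)) (by positivity)
  refine ⟨R, fun c => ?_⟩
  -- The tent sum contains `x + a k`, so an almost period `τ` moves the points by `-τ`; hence the
  -- signs.
  obtain ⟨τ, ⟨δ, hδ, hτ⟩, hball⟩ := hR (-c)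
  rw [Metric.mem_ball, Real.dist_eq] at hball
  refine ⟨-τ, by rw [← abs_neg]; convert hball using 2; ring, ?_⟩
  have hx := ha.isProperMonotone.div_const 0 hw0
  have hy := ha.isProperMonotone.div_const τ hw0
  have hgap : ∀ j : ℤ, ∃ p : ℤ, j * B ≤ p ∧ p < (j + 1) * B ∧
      ∀ k, 2 ≤ |(0 + a k) / w - p| := by
    intro j
    by_contra! hno
    -- The bound on `i` sits inside the existential so that `choose` yields a function on all of
    -- `ℕ`; the value for `i > M` is irrelevant.
    have hwin : ∀ i : ℕ, ∃ k, i ≤ M → |(0 + a k) / w - ((j * B + 4 * i + 2 : ℤ) : ℝ)| < 2 := by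
      intro i
      by_cases hi : i ≤ M
      · obtain ⟨k, hk⟩ := hno (j * B + 4 * i + 2) (by omega) (by rw [add_mul]; omega)
        exact ⟨k, fun _ => hk⟩
      · exact ⟨0, fun h => absurd h hi⟩
    choose k hk using hwin
    have hbd : ∀ i ≤ M, (j * B + 4 * i) * w < a (k i) ∧ a (k i) < (j * B + 4 * i + 4) * w := by
      intro i hi
      have h1 := hk i hi
      rw [abs_lt] at h1
      push_cast at h1
      rw [zero_add] at h1
      rw [← lt_div_iff₀ hw0, ← div_lt_iff₀ hw0]
      constructor <;> linarith
    have hgrow : ∀ i : ℕ, i ≤ M → k 0 + i ≤ k i := by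
      intro i
      induction i with
      | zero => simp
      | succ i ih =>
        intro hi
        have h1 := (hbd i (by omega)).2
        have h2 := (hbd (i + 1) hi).1
        have h3 : k i < k (i + 1) := by
          by_contra! hle
          have h4 := ha.monotone hle
          push_cast at h2
          linarith
        have h4 := ih (by omega)
        push_cast
        omega
    have h1 := (hbd 0 (Nat.zero_le _)).1
    have h2 := (hbd M le_rfl).2
    have h3 := ha.monotone (hgrow M le_rfl)
    have h4 := hM (k 0)
    have hBM' : (B : ℝ) = 4 * (M + 1) := by exact_mod_cast hBM
    have h5 : ((j : ℝ) * B + 4 * M + 4) * w = j * B * w + B * w := by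
      rw [hBM']
      ring
    push_cast at h1
    linarith
  have hF : ∀ i : ℤ, |∑' k, tent ((τ + a k) / w - i) - ∑' k, tent ((0 + a k) / w - i)| ≤ δ := by
    intro i
    have h1 : ∀ s t : ℝ, (s + t) / w - i = (-(i * w) + s + t) / w := fun s t => by
      field_simp
      ring
    simp_rw [h1]
    simpa only [add_zero] using hτ (-(i * w))
  have hB1 : 2 * B * δ < 1 := by
    have : 2 * B * δ < 2 * B * (1 / (4 * B)) := by gcongr
    have h2 : 2 * (B : ℝ) * (1 / (4 * B)) = 1 / 2 := by
      field_simp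
      norm_num
    linarith
  obtain ⟨h, hh⟩ := hx.exists_shift_abs_sub_le hy (by omega) hB1 hgap hF
  refine ⟨h, fun k => ?_⟩
  have h1 := hh k
  rw [← sub_div, abs_div, abs_of_pos hw0, div_le_iff₀ hw0] at h1
  refine le_trans (le_of_eq ?_) (h1.trans hwε)
  congr 1
  ring

end MultipleDiscreteSet

/-! ### Existence of the mean slope -/

section Slope

variable {a : ℤ → ℝ}

theorem abs_sub_sub_mul_le {h : ℤ} {τ ε : ℝ} (hh : ∀ k, |a (k + h) - a k - τ| ≤ ε) (n : ℕ)
    (k : ℤ) : |a (k + n * h) - a k - n * τ| ≤ n * ε := by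
  induction n with
  | zero => simp
  | succ n ih =>
    have h1 := hh (k + n * h)
    rw [show k + n * h + h = k + (n + 1 : ℕ) * h by push_cast; ring] at h1
    rw [abs_le] at *
    push_cast at *
    constructor <;> linarith

/-- The slope of a sequence with relatively dense approximate shifts. -/
theorem exists_slope (ha : Monotone a)
    (hshift : ∀ ε : ℝ, 0 < ε → ∃ R : ℝ, ∀ c : ℝ, ∃ τ : ℝ, |τ - c| < R ∧
      ∃ h : ℤ, ∀ k, |a (k + h) - a k - τ| ≤ ε) :
    ∃ α : ℝ, 0 < α ∧ ∀ (h : ℤ) (τ ε : ℝ), (∀ k, |a (k + h) - a k - τ| ≤ ε) →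
      |τ - α * h| ≤ ε := by
  -- Compare `n` steps of length `m` with `m` steps of length `n`: every lower slope bound is at
  -- most every upper one, so the supremum of the lower bounds serves as `α`.
  have hcross : ∀ (m n : ℕ) (τ σ ε δ : ℝ), 0 < m → 0 < n →
      (∀ k, |a (k + (m : ℤ)) - a k - τ| ≤ ε) → (∀ k, |a (k + (n : ℤ)) - a k - σ| ≤ δ) →
      (τ - ε) / m ≤ (σ + δ) / n := by
    intro m n τ σ ε δ hm hn h1 h2
    have h3 := abs_sub_sub_mul_le h1 n 0
    have h4 := abs_sub_sub_mul_le h2 m 0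
    rw [mul_comm (m : ℤ)] at h4
    rw [abs_le] at h3 h4
    have hm' : (0 : ℝ) < m := by exact_mod_cast hm
    have hn' : (0 : ℝ) < n := by exact_mod_cast hn
    rw [div_le_div_iff₀ hm' hn']
    linarith
  let S : Set ℝ := {s | ∃ (m : ℕ) (τ ε : ℝ), 0 < m ∧
    (∀ k, |a (k + (m : ℤ)) - a k - τ| ≤ ε) ∧ s = (τ - ε) / m}
  obtain ⟨m, τ, hm, hτ, hsh⟩ : ∃ (m : ℕ) (τ : ℝ), 0 < m ∧ 1 < τ ∧
      ∀ k, |a (k + (m : ℤ)) - a k - τ| ≤ 1 := by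
    obtain ⟨R, hR⟩ := hshift 1 one_pos
    -- This centre forces `τ > 1`, whence `h > 0` by monotonicity and the lower slope bound `(τ - 1)
    -- / m` is positive.
    obtain ⟨τ, hτ, h, hh⟩ := hR (1 + R)
    rw [abs_lt] at hτ
    have h0 : 0 < h := by
      by_contra! hle
      have h1 := ha hle
      have h2 := hh 0
      rw [zero_add, abs_le] at h2
      linarith
    lift h to ℕ using h0.le
    exact ⟨h, τ, by exact_mod_cast h0, by linarith, hh⟩
  have hm' : (0 : ℝ) < m := by exact_mod_cast hm
  have hmS : (τ - 1) / m ∈ S := ⟨m, τ, 1, hm, hsh, rfl⟩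
  have hub : ∀ (n : ℕ) (σ δ : ℝ), 0 < n → (∀ k, |a (k + (n : ℤ)) - a k - σ| ≤ δ) →
      (σ + δ) / n ∈ upperBounds S := by
    rintro n σ δ hn hh _ ⟨i, ρ, η, hi, hi', rfl⟩
    exact hcross i n ρ σ η δ hi hn hi' hh
  have hbdd : BddAbove S := ⟨_, hub m τ 1 hm hsh⟩
  have hpos : ∀ (n : ℕ) (σ δ : ℝ), 0 < n → (∀ k, |a (k + (n : ℤ)) - a k - σ| ≤ δ) →
      |σ - sSup S * n| ≤ δ := by
    intro n σ δ hn hh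
    have hn' : (0 : ℝ) < n := by exact_mod_cast hn
    have h1 : (σ - δ) / n ≤ sSup S := le_csSup hbdd ⟨n, σ, δ, hn, hh, rfl⟩
    have h2 : sSup S ≤ (σ + δ) / n := csSup_le ⟨_, hmS⟩ (hub n σ δ hn hh)
    rw [div_le_iff₀ hn'] at h1
    rw [le_div_iff₀ hn'] at h2
    rw [abs_le]
    constructor <;> linarith
  refine ⟨sSup S, lt_of_lt_of_le (div_pos (by linarith) hm') (le_csSup hbdd hmS),
    fun h σ δ hh => ?_⟩
  obtain ⟨n, rfl | rfl⟩ := h.eq_nat_or_neg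
  · rcases n.eq_zero_or_pos with rfl | hn
    · simpa using hh 0
    · simpa using hpos n σ δ hn hh
  · rcases n.eq_zero_or_pos with rfl | hn
    · simpa using hh 0
    · have := hpos n (-σ) δ hn fun k => by
        have h1 := hh (k + n)
        rw [add_neg_cancel_right, ← abs_neg] at h1
        convert h1 using 2
        ring
      rw [← abs_neg] at this
      convert this using 2
      push_cast
      ring

end Slope

/-! ### Interpolating almost periodic sequences -/

section Interpolation

/-- The piecewise linear interpolation of a two-sided sequence. -/
noncomputable def linearInterpolation (g : ℤ → ℝ) (x : ℝ) : ℝ :=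
  g ⌊x⌋ + Int.fract x * (g (⌊x⌋ + 1) - g ⌊x⌋)

variable {g : ℤ → ℝ}

@[simp]
theorem linearInterpolation_intCast (k : ℤ) : linearInterpolation g k = g k := by
  simp [linearInterpolation]

theorem linearInterpolation_of_mem_Icc {n : ℤ} {x : ℝ} (hx : x ∈ Set.Icc (n : ℝ) (n + 1)) :
    linearInterpolation g x = g n + (x - n) * (g (n + 1) - g n) := by
  rcases hx.2.eq_or_lt with h | h
  · have h1 : x = ((n + 1 : ℤ) : ℝ) := by
      rw [h]
      push_cast
      rfl
    rw [h1, linearInterpolation_intCast]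
    push_cast
    ring
  · have h1 : ⌊x⌋ = n := Int.floor_eq_iff.2 ⟨hx.1, h⟩
    rw [linearInterpolation, Int.fract, h1]

theorem continuous_linearInterpolation : Continuous (linearInterpolation g) := by
  have hlf : LocallyFinite fun n : ℤ => Set.Icc (n : ℝ) (n + 1) := by
    intro x
    refine ⟨Set.Icc (x - 1) (x + 1), Icc_mem_nhds (by linarith) (by linarith), ?_⟩
    refine (Set.finite_Icc ⌊x - 2⌋ ⌈x + 1⌉).subset ?_
    rintro n ⟨y, ⟨h1, h2⟩, h3, h4⟩
    constructor
    · have : x - 2 ≤ n := by linarith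
      exact_mod_cast (Int.floor_le _).trans this
    · have : (n : ℝ) ≤ x + 1 := by linarith
      exact_mod_cast this.trans (Int.le_ceil _)
  refine hlf.continuous ?_ (fun n => isClosed_Icc) fun n => ?_
  · exact Set.eq_univ_of_forall fun x =>
      Set.mem_iUnion.2 ⟨⌊x⌋, Int.floor_le x, (Int.lt_floor_add_one x).le⟩
  · refine ContinuousOn.congr (f := fun x => g n + (x - n) * (g (n + 1) - g n))
      (by fun_prop) fun x hx => linearInterpolation_of_mem_Icc hx

/-- An integer shift preserves the fractional part, so the increment is a convex combination of two
increments of `g`. -/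
theorem abs_linearInterpolation_add_sub_le {h : ℤ} {ε : ℝ} (hh : ∀ k, |g (k + h) - g k| ≤ ε)
    (x : ℝ) : |linearInterpolation g (x + h) - linearInterpolation g x| ≤ ε := by
  have h1 := hh ⌊x⌋
  have h2 := hh (⌊x⌋ + 1)
  have h3 := Int.fract_nonneg x
  have h4 := (Int.fract_lt_one x).le
  have h5 : linearInterpolation g (x + h) - linearInterpolation g x =
      (1 - Int.fract x) * (g (⌊x⌋ + h) - g ⌊x⌋) +
        Int.fract x * (g (⌊x⌋ + 1 + h) - g (⌊x⌋ + 1)) := by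
    rw [linearInterpolation, linearInterpolation, Int.floor_add_intCast, Int.fract_add_intCast,
      add_right_comm ⌊x⌋ h 1]
    ring
  rw [h5]
  rw [abs_le] at *
  constructor <;> nlinarith

theorem isAlmostPeriodic_linearInterpolation
    (hg : ∀ ε : ℝ, 0 < ε → ∃ R : ℝ, ∀ c : ℝ, ∃ h : ℤ, |(h : ℝ) - c| < R ∧
      ∀ k, |g (k + h) - g k| ≤ ε) : IsAlmostPeriodic (linearInterpolation g) := by
  refine ⟨continuous_linearInterpolation, fun ε hε => ?_⟩
  obtain ⟨R, hR⟩ := hg (ε / 2) (half_pos hε)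
  refine ⟨R, fun c => ?_⟩
  obtain ⟨h, hc, hh⟩ := hR c
  exact ⟨h, ⟨ε / 2, half_lt_self hε, abs_linearInterpolation_add_sub_le hh⟩, hc⟩

end Interpolation

/-! ### Density and conclusion -/

/-- A sequence at bounded distance from `α * k` has about `2 * R / α` terms in a ball of
radius `R`. -/
theorem abs_ncard_sub_le {a : ℤ → ℝ} {α C : ℝ} (hα : 0 < α) (hC : ∀ k : ℤ, |a k - α * k| ≤ C)
    (x : ℝ) {R : ℝ} (hR : C < R) :
    |({k : ℤ | a k ∈ Metric.ball x R}.ncard : ℝ) - 2 * R / α| ≤ 2 * C / α + 2 := by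
  have hC0 : 0 ≤ C := (abs_nonneg _).trans (hC 0)
  have hsup : {k : ℤ | a k ∈ Metric.ball x R} ⊆
      Finset.Icc ⌈(x - R - C) / α⌉ ⌊(x + R + C) / α⌋ := by
    intro k hk
    have h1 : |a k - x| < R := hk
    have h2 := hC k
    rw [abs_lt] at h1
    rw [abs_le] at h2
    rw [Finset.coe_Icc]
    refine ⟨Int.ceil_le.2 ?_, Int.le_floor.2 ?_⟩
    · rw [div_le_iff₀ hα]
      linarith
    · rw [le_div_iff₀ hα]
      linarith
  have hfin : {k : ℤ | a k ∈ Metric.ball x R}.Finite := (Finset.finite_toSet _).subset hsup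
  have hsub : ((Finset.Ioo ⌊(x - R + C) / α⌋ ⌈(x + R - C) / α⌉ : Finset ℤ) : Set ℤ) ⊆
      {k : ℤ | a k ∈ Metric.ball x R} := by
    intro k hk
    rw [Finset.coe_Ioo] at hk
    have h1 := Int.floor_lt.1 hk.1
    have h2 := Int.lt_ceil.1 hk.2
    rw [div_lt_iff₀ hα] at h1
    rw [lt_div_iff₀ hα] at h2
    have h3 := hC k
    rw [abs_le] at h3
    show |a k - x| < R
    rw [abs_lt]
    constructor <;> linarith
  have hle := Set.ncard_le_ncard hsup (Finset.finite_toSet _)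
  have hge := Set.ncard_le_ncard hsub hfin
  rw [Set.ncard_coe_finset, Int.card_Icc] at hle
  rw [Set.ncard_coe_finset, Int.card_Ioo] at hge
  have e1 := Int.floor_le ((x + R + C) / α)
  have e2 := Int.le_ceil ((x - R - C) / α)
  have e3 := Int.floor_le ((x - R + C) / α)
  have e4 := Int.le_ceil ((x + R - C) / α)
  have d1 : (x + R + C) / α - (x - R - C) / α = 2 * R / α + 2 * C / α := by ring
  have d2 : (x + R - C) / α - (x - R + C) / α = 2 * R / α - 2 * C / α := by ring
  have hlow : 2 * R / α - 2 * C / α - 1 ≤ ({k : ℤ | a k ∈ Metric.ball x R}.ncard : ℝ) := by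
    have h1 : ⌈(x + R - C) / α⌉ - ⌊(x - R + C) / α⌋ - 1 ≤
        ({k : ℤ | a k ∈ Metric.ball x R}.ncard : ℤ) :=
      (Int.self_le_toNat _).trans (by exact_mod_cast hge)
    have h2 : ((⌈(x + R - C) / α⌉ - ⌊(x - R + C) / α⌋ - 1 : ℤ) : ℝ) ≤
        ({k : ℤ | a k ∈ Metric.ball x R}.ncard : ℝ) := by exact_mod_cast h1
    push_cast at h2
    linarith
  have hup : ({k : ℤ | a k ∈ Metric.ball x R}.ncard : ℝ) ≤ 2 * R / α + 2 * C / α + 1 := by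
    have h0 : 0 ≤ 2 * R / α + 2 * C / α + 1 := by
      have : 0 < R := hC0.trans_lt hR
      positivity
    have h1 : (((⌊(x + R + C) / α⌋ + 1 - ⌈(x - R - C) / α⌉).toNat : ℕ) : ℝ) ≤
        2 * R / α + 2 * C / α + 1 := by
      rw [← Int.cast_natCast, Int.toNat_eq_max]
      push_cast
      refine max_le ?_ h0
      linarith
    exact le_trans (by exact_mod_cast hle) h1
  rw [abs_le]
  constructor <;> linarith

theorem MultipleDiscreteSet.IsEnumeration.hasDensity {A : MultipleDiscreteSet} {a : ℤ → ℝ}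
    (ha : A.IsEnumeration a) {α C : ℝ} (hα : 0 < α) (hC : ∀ k : ℤ, |a k - α * k| ≤ C) :
    A.HasDensity (1 / α) := by
  have hC0 : 0 ≤ C := (abs_nonneg _).trans (hC 0)
  refine Metric.tendstoUniformly_iff.2 fun ε hε => ?_
  have hlim : Tendsto (fun R : ℝ => (2 * C / α + 2) / (2 * R)) atTop (nhds 0) :=
    Tendsto.const_div_atTop (tendsto_id.const_mul_atTop two_pos) _
  filter_upwards [hlim.eventually (gt_mem_nhds hε), eventually_gt_atTop C] with R hR hRC x
  have hR0 : 0 < R := hC0.trans_lt hRC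
  refine lt_of_le_of_lt ?_ hR
  have hball : Metric.ball x R ⊆ Set.Icc (x - R) (x + R) := by
    rw [← Real.closedBall_eq_Icc]
    exact Metric.ball_subset_closedBall
  have h2R : 0 < 2 * R := by positivity
  rw [dist_comm, Real.dist_eq, ha.card_eq_ncard hball,
    show 1 / α = (2 * R / α) / (2 * R) by field_simp, ← sub_div, abs_div, abs_of_pos h2R]
  gcongr
  exact abs_ncard_sub_le hα hC x hRC

theorem mainTheorem1 (A : MultipleDiscreteSet) (a : ℤ → ℝ)
    (hA : A.AlmostPeriodic) (ha : A.IsEnumeration a) :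
    ∃ D : ℝ, 0 < D ∧ A.HasDensity D ∧
      ∃ f : ℝ → ℝ, IsAlmostPeriodic f ∧ ∀ k : ℤ, a k = (k : ℝ) / D + f (k : ℝ) := by
  obtain ⟨α, hα, hslope⟩ := exists_slope ha.monotone fun ε hε => hA.exists_shift ha hε
  have hf : IsAlmostPeriodic (linearInterpolation fun k => a k - α * k) := by
    refine isAlmostPeriodic_linearInterpolation fun ε hε => ?_
    obtain ⟨R, hR⟩ := hA.exists_shift ha (half_pos hε)
    -- `τ` is within `R` of `α * c` and within `ε / 2` of `α * h`; dividing by `α` places `h` near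
    -- `c`.
    refine ⟨(R + ε / 2) / α, fun c => ?_⟩
    obtain ⟨τ, hτ, h, hh⟩ := hR (α * c)
    have h1 := hslope h τ _ hh
    refine ⟨h, ?_, fun k => ?_⟩
    · rw [lt_div_iff₀ hα, ← abs_of_pos hα, ← abs_mul]
      rw [abs_le] at h1
      rw [abs_lt] at hτ ⊢
      constructor <;> linarith
    · have h2 := hh k
      push_cast
      rw [abs_le] at *
      constructor <;> linarith
  obtain ⟨C, hC⟩ := hf.exists_abs_le
  refine ⟨1 / α, one_div_pos.2 hα, ha.hasDensity hα (C := C) fun k => ?_, _, hf, fun k => ?_⟩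
  · simpa using hC k
  · rw [linearInterpolation_intCast, div_div_eq_mul_div, div_one]
    ring
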